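/- Consider the linear time-invariant system $\dot x = Ax + Bu$, $y = Cx + Du$ with $A \in \mathbb{R}^{n\times n}$, $B \in \mathbb{R}^{n\times m}$, $C \in \mathbb{R}^{m\times n}$, $D \in \mathbb{R}^{m\times m}$, and assume that $A$ is Hurwitz (all its complex eigenvalues have negative real part). Let $g(t) = Ce^{At}B$, and let $h(t) = D\delta(t) + g(t)$ be the impulse response, where $\delta$ is the Dirac delta. Then, for every $u \in L_2(\mathbb{R}_{\ge 0},\mathbb{R}^m)$, the integral $$(\Gamma_h u)(t) = \int_0^\infty h(t+\tau)u(\tau)\,d\tau$$ converges for every $t\ge 0$ (its regular part $\int_0^\infty g(t+\tau)u(\tau)\,d\tau$ absolutely, while the term $D\delta$ contributes only at $t=0$) and defines an element of $L_2(\mathbb{R}_{\ge 0},\mathbb{R}^m)$, so that the Hankel operator $\Gamma_h$ is a well-defined operator on $L_2(\mathbb{R}_{\ge 0},\mathbb{R}^m)$. The system is called a relaxation system if $D = D^{\mathsf T} \succeq 0$ and $g$ is completely monotonic on $[0,\infty)$, that is, $g(t) = g(t)^{\mathsf T}$ for all $t \ge 0$ and $(-1)^k \frac{d^k}{dt^k}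 g(t) \succeq 0$ for all $k = 1, 2, \ldots$ and all $t \ge 0$. (Since $g(t)\to 0$ as $t\to\infty$, this also gives $g(t)\succeq 0$.) An operator $T$ on a real Hilbert space $\mathcal{H}$ is called cyclic monotone if, for all $N \ge 1$ and all $u_0, \ldots, u_N \in \mathcal{H}$, with $y_i = T(u_i)$, $$\langle y_0, u_0 - u_1\rangle + \langle y_1, u_1 - u_2\rangle + \cdots + \langle y_N, u_N - u_0\rangle \ge 0.$$ The system is a relaxation system if and only if $\Gamma_h$ is cyclic monotone and $D = D^{\mathsf T} \succeq 0$. Moreover, $\Gamma_h$ is cyclic monotone if and only if it is self-adjoint ($\langle \Gamma_h u, w\rangle = \langle u, \Gamma_h w\rangle$ for all $u, w$) and positive ($\langle \Gamma_h u, u\rangle \ge 0$ for all $u$). -/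

import Mathlib

open MeasureTheory
open scoped Matrix ContDiff

/-- The linear time-invariant state-space system `x' = A x + B u`, `y = C x + D u` with
`n` states, `m` inputs and `p` outputs. -/
structure LTISystem (n m p : ℕ) where
  A : Matrix (Fin n) (Fin n) ℝ
  B : Matrix (Fin n) (Fin m) ℝ
  C : Matrix (Fin p) (Fin n) ℝ
  D : Matrix (Fin p) (Fin m) ℝ

/-- A real square matrix is Hurwitz if all its complex eigenvalues have negative real part. -/
def IsHurwitz {n : ℕ} (A : Matrix (Fin n) (Fin n) ℝ) : Prop :=
  ∀ z ∈ spectrum ℂ (A.map (algebraMap ℝ ℂ)), z.re < 0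

/-- The Hilbert space `L₂(ℝ_{≥0}, ℝ^m)`, with inner product `∫₀^∞ u(t)ᵀ y(t) dt`. -/
abbrev L2Signal (m : ℕ) : Type :=
  Lp (EuclideanSpace ℝ (Fin m)) 2 (volume.restrict (Set.Ici (0 : ℝ)))

/-- A matrix-valued function `G` on `[0, ∞)` is completely monotonic: it is smooth on `[0, ∞)`
(with one-sided derivatives at `0`), symmetric, and `(-1)^k G^{(k)}(t) ⪰ 0` for all `k ≥ 1` and
`t ≥ 0`.  Derivatives are taken entrywise. -/
def IsCompletelyMonotonic {m : ℕ} (G : ℝ → Matrix (Fin m) (Fin m) ℝ) : Prop :=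
  (∀ i j, ContDiffOn ℝ ∞ (fun t => G t i j) (Set.Ici 0)) ∧
  (∀ t, 0 ≤ t → G t = (G t)ᵀ) ∧
  ∀ k : ℕ, 1 ≤ k → ∀ t, 0 ≤ t →
    ((-1 : ℝ) ^ k •
      Matrix.of fun i j => iteratedDerivWithin k (fun s => G s i j) (Set.Ici 0) t).PosSemidef

namespace LTISystem

/-- The impulse response without the feedthrough term, `g(t) = C e^{At} B`. -/
noncomputable def g {n m p : ℕ} (S : LTISystem n m p) (t : ℝ) : Matrix (Fin p) (Fin m) ℝ :=
  S.C * NormedSpace.exp (t • S.A) * S.B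

/-- A relaxation system: `D = Dᵀ ⪰ 0` and `g` is completely monotonic on `[0, ∞)`. -/
def IsRelaxation {n m : ℕ} (S : LTISystem n m m) : Prop :=
  (S.D = S.Dᵀ ∧ S.D.PosSemidef) ∧ IsCompletelyMonotonic S.g

/-- The integrand `τ ↦ g(t + τ) u(τ)`. -/
noncomputable def hankelIntegrand {n m p : ℕ} (S : LTISystem n m p)
    (u : ℝ → EuclideanSpace ℝ (Fin m)) (t τ : ℝ) : EuclideanSpace ℝ (Fin p) :=
  WithLp.toLp 2 (S.g (t + τ) *ᵥ (u τ).ofLp)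

/-- The function `t ↦ ∫₀^∞ h(t + τ) u(τ) dτ` for the impulse response `h = D δ + g`.  As a
function of `τ`, the impulse `δ(t + τ)` is the Dirac mass at `τ = -t`, so the feedthrough term
only contributes at `t = 0`. -/
noncomputable def hankelFun {n m p : ℕ} (S : LTISystem n m p)
    (u : ℝ → EuclideanSpace ℝ (Fin m)) (t : ℝ) : EuclideanSpace ℝ (Fin p) :=
  (∫ τ in Set.Ici (0 : ℝ), WithLp.toLp 2 (S.D *ᵥ (u τ).ofLp) ∂(Measure.dirac (-t))) +
    ∫ τ in Set.Ici (0 : ℝ), S.hankelIntegrand u t τ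

/-- The Hankel integrals converge and define a map `L₂(ℝ_{≥0}, ℝ^m) → L₂(ℝ_{≥0}, ℝ^p)`. -/
def HankelWellDefined {n m p : ℕ} (S : LTISystem n m p) : Prop :=
  ∀ u : L2Signal m,
    (∀ t, 0 ≤ t → IntegrableOn (S.hankelIntegrand u t) (Set.Ici 0)) ∧
    MemLp (S.hankelFun u) 2 (volume.restrict (Set.Ici (0 : ℝ)))

open Classical in
/-- The Hankel operator `Γ_h`, `(Γ_h u)(t) = ∫₀^∞ h(t + τ) u(τ) dτ`.  The value `0` is used
only where the integral does not define a square-integrable function. -/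
noncomputable def hankel {n m p : ℕ} (S : LTISystem n m p) (u : L2Signal m) : L2Signal p :=
  if hu : MemLp (S.hankelFun u) 2 (volume.restrict (Set.Ici (0 : ℝ))) then
    hu.toLp (S.hankelFun u)
  else 0

end LTISystem

section Operators

variable {H : Type*} [NormedAddCommGroup H] [InnerProductSpace ℝ H]

/-- `N`-cyclic monotonicity of `T : H → H`: for all `u_0, …, u_N` and `y_i = T(u_i)`,
`⟨y_0, u_0 - u_1⟩ + ⟨y_1, u_1 - u_2⟩ + … + ⟨y_N, u_N - u_0⟩ ≥ 0`.
Addition in `Fin (N + 1)` is cyclic. -/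
def IsNCyclicMonotone (N : ℕ) (T : H → H) : Prop :=
  ∀ u : Fin (N + 1) → H, 0 ≤ ∑ i, inner ℝ (T (u i)) (u i - u (i + 1))

/-- Cyclic monotonicity: `N`-cyclic monotonicity for all `N ≥ 1`. -/
def IsCyclicMonotone (T : H → H) : Prop :=
  ∀ N : ℕ, 1 ≤ N → IsNCyclicMonotone N T

/-- `T` is self-adjoint: `⟨T u, y⟩ = ⟨u, T y⟩` for all `u`, `y`. -/
def IsSelfAdjointOperator (T : H → H) : Prop :=
  ∀ u y : H, inner ℝ (T u) y = inner ℝ u (T y)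

/-- `T` is positive: `⟨T u, u⟩ ≥ 0` for all `u`. -/
def IsPositiveOperator (T : H → H) : Prop :=
  ∀ u : H, 0 ≤ inner ℝ (T u) u

end Operators

/-! Two equivalences are combined.

For a linear operator `T`, cyclic monotonicity means self-adjoint and positive
(`isCyclicMonotone_iff`). If `T` is self-adjoint and positive, it is the gradient of the convex
function `u ↦ ⟨T u, u⟩ / 2`, and the cyclic sum telescopes up to nonnegative terms. Conversely,
testing on polygons inscribed in an ellipse bounds the skew part of `T` by `tan (π / (N + 1))` times
its symmetric part, and `N → ∞` removes it.

The Hankel operator factors through a finite-dimensional space, because `g (s + t) = (C e^{sA})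
(e^{tA} B)`: by `inner_hankel`, `⟨Γ u, w⟩` is a bilinear form in the states produced by `u` and `w`.
By `range_momentMap`, square-integrable signals reach exactly the span of the states produced by
impulses. Hence self-adjointness of `Γ` is symmetry of `g` on `[0, ∞)`, and positivity of `Γ` is
positivity of the kernel `g (s + t)`.

It remains to see that, for symmetric `g` tending to `0`, this kernel is positive exactly when `g`
is completely monotonic. Positivity makes the quadratic sums convex in a shift and hence decreasing,
so it passes to `-g'` (`IsHankelPositive.neg_deriv`). The converse replaces Bernstein's
representation by Taylor expansion at a point going to infinity (`isHankelPositive_of_hasSum`). The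
Hurwitz assumption supplies the exponential decay used throughout. -/

/-! ### Cyclic monotone linear operators. -/

section CyclicMonotone

variable {H : Type*} [NormedAddCommGroup H] [InnerProductSpace ℝ H]

/-- The regular polygon with `N + 1` vertices on the ellipse spanned by `u` and `v`. -/
noncomputable def ellipsePolygon (N : ℕ) (u v : H) (i : Fin (N + 1)) : H :=
  Real.cos (2 * Real.pi / (N + 1) * i) • u + Real.sin (2 * Real.pi / (N + 1) * i) • v

/-- Moving to the next vertex is a rotation in the parameter plane, in which the quarter turn sends
`(u, v)` to `(v, -u)`. -/
theorem ellipsePolygon_add_one (N : ℕ) (u v : H) (i : Fin (N + 1)) :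
    ellipsePolygon N u v (i + 1) =
      Real.cos (2 * Real.pi / (N + 1)) • ellipsePolygon N u v i +
        Real.sin (2 * Real.pi / (N + 1)) • ellipsePolygon N v (-u) i := by
  have key : ∀ x : ℝ, Real.cos (x + 2 * Real.pi / (N + 1)) • u +
      Real.sin (x + 2 * Real.pi / (N + 1)) • v =
      Real.cos (2 * Real.pi / (N + 1)) • (Real.cos x • u + Real.sin x • v) +
        Real.sin (2 * Real.pi / (N + 1)) • (Real.cos x • v + Real.sin x • (-u)) := by
    intro x
    rw [Real.cos_add, Real.sin_add]
    module
  unfold ellipsePolygon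
  rw [← key]
  -- At the last index `i + 1` wraps to `0`, and the angle has completed a full turn.
  by_cases hi : i = Fin.last N
  · subst hi
    have h : 2 * Real.pi / (N + 1) * ((Fin.last N : Fin (N + 1)) : ℕ) + 2 * Real.pi / (N + 1)
        = 2 * Real.pi := by
      have : (N : ℝ) + 1 ≠ 0 := by positivity
      simp only [Fin.val_last]
      field_simp
    rw [h]
    simp
  · have h : ((i + 1 : Fin (N + 1)) : ℕ) = (i : ℕ) + 1 := by
      rw [Fin.val_add_one]
      simp [hi]
    rw [h]
    push_cast
    rw [mul_add, mul_one]

theorem IsCyclicMonotone.isPositiveOperator {T : H →ₗ[ℝ] H} (hT : IsCyclicMonotone T) :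
    IsPositiveOperator T := by
  intro u
  have h := hT 1 le_rfl ![u, 0]
  simpa [Fin.sum_univ_two] using h

/-- The cyclic sums of two polygons a quarter turn apart are added: `sin² + cos² = 1` then makes
every term independent of the vertex, so no trigonometric sum has to be evaluated. -/
theorem IsCyclicMonotone.inner_sub_inner_le {T : H →ₗ[ℝ] H} (hT : IsCyclicMonotone T) (u v : H)
    {N : ℕ} (hN : 1 ≤ N) :
    Real.sin (2 * Real.pi / (N + 1)) * (inner ℝ (T u) v - inner ℝ (T v) u) ≤
      (1 - Real.cos (2 * Real.pi / (N + 1))) * (inner ℝ (T u) u + inner ℝ (T v) v) := by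
  have h := add_nonneg (hT N hN (ellipsePolygon N u v)) (hT N hN (ellipsePolygon N v (-u)))
  rw [← Finset.sum_add_distrib] at h
  have hterm : ∀ i : Fin (N + 1),
      inner ℝ (T (ellipsePolygon N u v i))
          (ellipsePolygon N u v i - ellipsePolygon N u v (i + 1)) +
        inner ℝ (T (ellipsePolygon N v (-u) i))
          (ellipsePolygon N v (-u) i - ellipsePolygon N v (-u) (i + 1)) =
      (1 - Real.cos (2 * Real.pi / (N + 1))) * (inner ℝ (T u) u + inner ℝ (T v) v) -
        Real.sin (2 * Real.pi / (N + 1)) * (inner ℝ (T u) v - inner ℝ (T v) u) := by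
    intro i
    rw [ellipsePolygon_add_one, ellipsePolygon_add_one]
    unfold ellipsePolygon
    simp only [map_add, map_smul, map_neg, inner_add_left, inner_sub_right, inner_add_right,
      inner_smul_left, inner_smul_right, inner_neg_left, inner_neg_right, smul_neg,
      RCLike.conj_to_real]
    have h1 := Real.sin_sq_add_cos_sq (2 * Real.pi / (N + 1) * (i : ℕ))
    generalize Real.sin (2 * Real.pi / (N + 1) * (i : ℕ)) = s at *
    generalize Real.cos (2 * Real.pi / (N + 1) * (i : ℕ)) = c at *
    linear_combination ((1 - Real.cos (2 * Real.pi / (N + 1))) *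
        (inner ℝ (T u) u + inner ℝ (T v) v) -
        Real.sin (2 * Real.pi / (N + 1)) * (inner ℝ (T u) v - inner ℝ (T v) u)) * h1
  rw [Finset.sum_congr rfl fun i _ => hterm i, Finset.sum_const, Finset.card_univ,
    Fintype.card_fin, nsmul_eq_mul] at h
  have hpos : (0 : ℝ) < ((N + 1 : ℕ) : ℝ) := by positivity
  have := nonneg_of_mul_nonneg_right h hpos
  linarith

theorem IsCyclicMonotone.inner_le_inner {T : H →ₗ[ℝ] H} (hT : IsCyclicMonotone T) (u v : H) :
    inner ℝ (T u) v ≤ inner ℝ (T v) u := by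
  set S := inner ℝ (T u) u + inner ℝ (T v) v with hS
  set P := inner ℝ (T u) v - inner ℝ (T v) u with hP
  have hS0 : 0 ≤ S := add_nonneg (hT.isPositiveOperator u) (hT.isPositiveOperator v)
  -- With `x = π / (N + 1)`, half-angle formulas allow division by `2 sin x cos x`; `2 ≤ N` ensures
  -- `x < π / 2`.
  have htan : ∀ N : ℕ, 2 ≤ N → P ≤ Real.tan (Real.pi / (N + 1)) * S := by
    intro N hN
    have h := hT.inner_sub_inner_le u v (N := N) (by omega)
    set x := Real.pi / (N + 1) with hx
    have hx2 : 2 * Real.pi / (N + 1) = 2 * x := by rw [hx]; ring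
    have hN' : (2 : ℝ) ≤ N := by exact_mod_cast hN
    have hx0 : 0 < x := by positivity
    have hx1 : x < Real.pi / 2 := by
      rw [hx]
      exact div_lt_div_of_pos_left Real.pi_pos two_pos (by linarith)
    have hs : 0 < Real.sin x := Real.sin_pos_of_pos_of_lt_pi hx0 (by linarith)
    have hc : 0 < Real.cos x := Real.cos_pos_of_mem_Ioo ⟨by linarith, hx1⟩
    rw [hx2, Real.sin_two_mul, Real.cos_two_mul'] at h
    rw [Real.tan_eq_sin_div_cos, div_mul_eq_mul_div, le_div_iff₀ hc]
    have h1 : 1 - (Real.cos x ^ 2 - Real.sin x ^ 2) = 2 * Real.sin x * Real.sin x := by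
      linarith [Real.sin_sq_add_cos_sq x]
    rw [h1] at h
    have : (2 * Real.sin x) * (P * Real.cos x) ≤ (2 * Real.sin x) * (Real.sin x * S) := by
      linarith
    exact le_of_mul_le_mul_left this (by positivity)
  have hlim : Filter.Tendsto (fun N : ℕ => Real.tan (Real.pi / (N + 1)) * S) Filter.atTop
      (nhds (Real.tan 0 * S)) := by
    refine Filter.Tendsto.mul_const _ ?_
    refine (Real.continuousAt_tan.2 (by simp)).tendsto.comp ?_
    have := (tendsto_one_div_add_atTop_nhds_zero_nat (𝕜 := ℝ)).const_mul Real.pi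
    simpa [div_eq_mul_inv] using this
  rw [Real.tan_zero, zero_mul] at hlim
  have := ge_of_tendsto hlim (Filter.eventually_atTop.2 ⟨2, htan⟩)
  linarith

theorem IsCyclicMonotone.isSelfAdjointOperator {T : H →ₗ[ℝ] H} (hT : IsCyclicMonotone T) :
    IsSelfAdjointOperator T := by
  intro u v
  rw [real_inner_comm (T v) u]
  exact le_antisymm (hT.inner_le_inner u v) (hT.inner_le_inner v u)

theorem IsSelfAdjointOperator.isCyclicMonotone {T : H →ₗ[ℝ] H} (hs : IsSelfAdjointOperator T)
    (hp : IsPositiveOperator T) : IsCyclicMonotone T := by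
  intro N _ u
  -- Exact second-order expansion of the potential `⟨T u, u⟩ / 2`: a nonnegative remainder plus a
  -- difference that telescopes around the cycle.
  have hterm : ∀ i : Fin (N + 1), inner ℝ (T (u i)) (u i - u (i + 1)) =
      2⁻¹ * inner ℝ (T (u i - u (i + 1))) (u i - u (i + 1)) +
        2⁻¹ * (inner ℝ (T (u i)) (u i) - inner ℝ (T (u (i + 1))) (u (i + 1))) := by
    intro i
    have h1 : inner ℝ (T (u (i + 1))) (u i) = inner ℝ (T (u i)) (u (i + 1)) := by
      rw [hs, real_inner_comm]
    simp only [map_sub, inner_sub_left, inner_sub_right, h1]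
    ring
  have hshift : ∑ i, inner ℝ (T (u (i + 1))) (u (i + 1)) = ∑ i, inner ℝ (T (u i)) (u i) :=
    Equiv.sum_comp (Equiv.addRight (1 : Fin (N + 1))) fun i => inner ℝ (T (u i)) (u i)
  rw [Finset.sum_congr rfl fun i _ => hterm i, Finset.sum_add_distrib, ← Finset.mul_sum,
    ← Finset.mul_sum, Finset.sum_sub_distrib, hshift, sub_self, mul_zero, add_zero]
  exact mul_nonneg (by norm_num) (Finset.sum_nonneg fun i _ => hp _)

theorem isCyclicMonotone_iff (T : H →ₗ[ℝ] H) :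
    IsCyclicMonotone T ↔ IsSelfAdjointOperator T ∧ IsPositiveOperator T :=
  ⟨fun h => ⟨h.isSelfAdjointOperator, h.isPositiveOperator⟩,
    fun h => h.1.isCyclicMonotone h.2⟩

end CyclicMonotone

/-! ### Exponential decay and Taylor expansion of the matrix exponential. -/

section MatrixExp

open scoped Matrix.Norms.Operator

variable {n : ℕ}

theorem Matrix.exp_map_complex (A : Matrix (Fin n) (Fin n) ℝ) :
    NormedSpace.exp (A.map (algebraMap ℝ ℂ)) = (NormedSpace.exp A).map (algebraMap ℝ ℂ) := by
  have h : Continuous ((algebraMap ℝ ℂ).mapMatrix : Matrix (Fin n) (Fin n) ℝ →+* _) := by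
    exact Continuous.matrix_map continuous_id (by exact Complex.continuous_ofReal)
  exact (NormedSpace.map_exp ((algebraMap ℝ ℂ).mapMatrix : Matrix (Fin n) (Fin n) ℝ →+* _) h A).symm

theorem Matrix.exp_mulVec_of_mulVec_eq_smul {A : Matrix (Fin n) (Fin n) ℂ} {v : Fin n → ℂ} {μ : ℂ}
    (h : A *ᵥ v = μ • v) : NormedSpace.exp A *ᵥ v = Complex.exp μ • v := by
  have hpow : ∀ k : ℕ, A ^ k *ᵥ v = μ ^ k • v := by
    intro k
    induction k with
    | zero => simp
    | succ k ih =>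
      rw [pow_succ', ← Matrix.mulVec_mulVec, ih, Matrix.mulVec_smul, h, smul_smul, pow_succ]
  have h1 := NormedSpace.exp_series_hasSum_exp' (𝕂 := ℂ) A
  have h2 := NormedSpace.exp_series_hasSum_exp' (𝕂 := ℂ) μ
  let L : Matrix (Fin n) (Fin n) ℂ →+ (Fin n → ℂ) :=
    ⟨⟨fun M => M *ᵥ v, Matrix.zero_mulVec v⟩, fun M N => Matrix.add_mulVec M N v⟩
  have h3 := h1.map L (by
    show Continuous fun M : Matrix (Fin n) (Fin n) ℂ => M *ᵥ v
    exact Continuous.matrix_mulVec continuous_id continuous_const)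
  have h4 := h2.smul_const v
  rw [← Complex.exp_eq_exp_ℂ] at h4
  refine h3.unique ?_
  convert h4 using 2 with k
  simp [L, Matrix.smul_mulVec, hpow, smul_smul]

/-- `A` commutes with `exp A`, so it preserves the eigenspace of `exp A` for `z` and has an
eigenvector there; its eigenvalue `μ` satisfies `exp μ = z`. -/
theorem Matrix.spectrum_exp_subset (A : Matrix (Fin n) (Fin n) ℂ) :
    spectrum ℂ (NormedSpace.exp A) ⊆ Complex.exp '' spectrum ℂ A := by
  intro z hz
  rw [← Matrix.spectrum_toLin', ← Module.End.hasEigenvalue_iff_mem_spectrum] at hz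
  set E : Module.End ℂ (Fin n → ℂ) := Matrix.toLin' (NormedSpace.exp A) with hE
  have hmaps : ∀ x ∈ E.eigenspace z, Matrix.toLin' A x ∈ E.eigenspace z := by
    intro x hx
    rw [Module.End.mem_eigenspace_iff] at hx ⊢
    have hc : Commute (NormedSpace.exp A) A := (Commute.refl A).exp_left
    simp only [hE, Matrix.toLin'_apply] at hx ⊢
    rw [Matrix.mulVec_mulVec, hc.eq, ← Matrix.mulVec_mulVec, hx, Matrix.mulVec_smul]
  have hnt : Nontrivial (E.eigenspace z) := Submodule.nontrivial_iff_ne_bot.2 hz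
  obtain ⟨μ, hμ⟩ := Module.End.exists_eigenvalue ((Matrix.toLin' A).restrict hmaps)
  obtain ⟨w, hw⟩ := hμ.exists_hasEigenvector
  have hw0 : (w : Fin n → ℂ) ≠ 0 := by simpa using hw.2
  have hAw : A *ᵥ (w : Fin n → ℂ) = μ • (w : Fin n → ℂ) := by
    have := congrArg Subtype.val hw.apply_eq_smul
    simpa using this
  refine ⟨μ, ?_, ?_⟩
  · rw [← Matrix.spectrum_toLin', ← Module.End.hasEigenvalue_iff_mem_spectrum]
    exact Module.End.hasEigenvalue_of_hasEigenvector (x := (w : Fin n → ℂ))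
      ⟨Module.End.mem_eigenspace_iff.2 (by simpa using hAw), hw0⟩
  · have h1 := Matrix.exp_mulVec_of_mulVec_eq_smul hAw
    have h2 := Module.End.mem_eigenspace_iff.1 w.2
    exact smul_left_injective ℂ hw0 (h1.symm.trans h2)

/-- Gelfand's formula, with `r` chosen strictly between the spectral radius and `1`. -/
theorem spectrum.exists_norm_pow_le {A : Type*} [NormedRing A] [NormedAlgebra ℂ A]
    [CompleteSpace A] (a : A) (h : ∀ z ∈ spectrum ℂ a, ‖z‖ < 1) :
    ∃ r : ℝ, 0 < r ∧ r < 1 ∧ ∀ᶠ k : ℕ in Filter.atTop, ‖a ^ k‖ ≤ r ^ k := by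
  rcases subsingleton_or_nontrivial A with hA | hA
  · refine ⟨1 / 2, by norm_num, by norm_num, Filter.Eventually.of_forall fun k => ?_⟩
    rw [Subsingleton.elim (a ^ k) 0, norm_zero]
    positivity
  have hlt : spectralRadius ℂ a < (1 : NNReal) :=
    spectrum.spectralRadius_lt_of_forall_lt a fun z hz => by exact_mod_cast h z hz
  obtain ⟨r, hr1, hr2⟩ := ENNReal.lt_iff_exists_nnreal_btwn.1 hlt
  have hr0 : 0 < r := by
    exact_mod_cast lt_of_le_of_lt (zero_le) hr1
  refine ⟨r, by exact_mod_cast hr0, by exact_mod_cast hr2, ?_⟩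
  have hlim := (spectrum.pow_nnnorm_pow_one_div_tendsto_nhds_spectralRadius a).eventually_lt_const hr1
  filter_upwards [hlim, Filter.eventually_gt_atTop 0] with k hk hk0
  have h1 := ENNReal.rpow_le_rpow hk.le (z := (k : ℝ)) (by positivity)
  rw [← ENNReal.rpow_mul, one_div, inv_mul_cancel₀ (by positivity), ENNReal.rpow_one,
    ENNReal.rpow_natCast] at h1
  exact_mod_cast h1

theorem Matrix.norm_apply_le (M : Matrix (Fin n) (Fin n) ℂ) (i j : Fin n) : ‖M i j‖ ≤ ‖M‖ := by
  have h : ‖M i j‖₊ ≤ ‖M‖₊ := by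
    rw [Matrix.linfty_opNNNorm_def]
    refine le_trans ?_ (Finset.le_sup (f := fun i => ∑ j, ‖M i j‖₊) (Finset.mem_univ i))
    exact Finset.single_le_sum (f := fun j => ‖M i j‖₊) (fun _ _ => zero_le) (Finset.mem_univ j)
  exact h

theorem IsHurwitz.exists_abs_exp_le {A : Matrix (Fin n) (Fin n) ℝ} (hA : IsHurwitz A) :
    ∃ M α : ℝ, 0 < α ∧ ∀ t : ℝ, 0 ≤ t → ∀ i j,
      |NormedSpace.exp (t • A) i j| ≤ M * Real.exp (-α * t) := by
  set Ac := A.map (algebraMap ℝ ℂ) with hAc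
  obtain ⟨r, hr0, hr1, hr⟩ := spectrum.exists_norm_pow_le (NormedSpace.exp Ac) (by
    intro z hz
    obtain ⟨μ, hμ, rfl⟩ := Matrix.spectrum_exp_subset Ac hz
    rw [Complex.norm_exp, Real.exp_lt_one_iff]
    exact hA μ hμ)
  obtain ⟨K, hK⟩ := Filter.eventually_atTop.1 hr
  have hcont : Continuous fun s : ℝ => NormedSpace.exp ((s : ℂ) • Ac) :=
    NormedSpace.exp_continuous.comp (by fun_prop)
  obtain ⟨R, hR⟩ := isCompact_Icc.exists_bound_of_continuousOn
    (s := Set.Icc (0 : ℝ) (K + 1)) hcont.continuousOn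
  have hexp : ∀ t : ℝ, NormedSpace.exp ((t : ℂ) • Ac) =
      (NormedSpace.exp (t • A)).map (algebraMap ℝ ℂ) := by
    intro t
    rw [← Matrix.exp_map_complex]
    congr 1
    ext i j
    simp [hAc]
  set α := -Real.log r with hα
  have hα0 : 0 < α := by
    rw [hα]
    linarith [Real.log_neg hr0 hr1]
  have hrα : r = Real.exp (-α) := by rw [hα, neg_neg, Real.exp_log hr0]
  have hR0 : 0 ≤ R := (norm_nonneg _).trans (hR 0 ⟨le_rfl, by positivity⟩)
  -- `R` bounds `e^{tA}` on `[0, K + 1]`, where the exponential factor is at least `1`. For larger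
  -- `t`, `R` bounds the fractional part of the flow, and `r ^ ⌊t⌋ ≤ e^{-α (t - 1)}` bounds the
  -- integer part.
  refine ⟨R * Real.exp (α * (K + 1)), α, hα0, fun t ht i j => ?_⟩
  have hent : |NormedSpace.exp (t • A) i j| ≤ ‖NormedSpace.exp ((t : ℂ) • Ac)‖ := by
    refine le_trans (le_of_eq ?_) (Matrix.norm_apply_le _ i j)
    rw [hexp]
    simp
  refine hent.trans ?_
  by_cases htK : t ≤ K + 1
  · refine (hR t ⟨ht, htK⟩).trans ?_
    rw [mul_assoc, ← Real.exp_add]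
    refine le_mul_of_one_le_right hR0 (Real.one_le_exp ?_)
    nlinarith
  · push Not at htK
    have hfl := Nat.floor_le ht
    have hfl2 := Nat.lt_floor_add_one t
    have hKfl : K ≤ ⌊t⌋₊ := Nat.le_floor (by linarith)
    have hsplit : NormedSpace.exp ((t : ℂ) • Ac) =
        NormedSpace.exp (((t - ⌊t⌋₊ : ℝ) : ℂ) • Ac) * NormedSpace.exp Ac ^ ⌊t⌋₊ := by
      rw [← Matrix.exp_nsmul, ← Matrix.exp_add_of_commute]
      · congr 1
        rw [← Nat.cast_smul_eq_nsmul ℂ, ← add_smul]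
        push_cast
        ring_nf
      · exact ((Commute.refl Ac).smul_left _).smul_right _
    rw [hsplit]
    refine (norm_mul_le _ _).trans ?_
    have h1 := hR (t - ⌊t⌋₊) ⟨by linarith, by
      have : (0 : ℝ) ≤ K := by positivity
      linarith⟩
    have h2 := hK _ hKfl
    rw [mul_assoc, ← Real.exp_add]
    refine mul_le_mul h1 (h2.trans ?_) (norm_nonneg _) hR0
    rw [hrα, ← Real.exp_nat_mul]
    refine Real.exp_le_exp.2 ?_
    have : (0 : ℝ) ≤ K := by positivity
    nlinarith

theorem Matrix.continuous_exp_smul (A : Matrix (Fin n) (Fin n) ℝ) :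
    Continuous fun t : ℝ => NormedSpace.exp (t • A) :=
  NormedSpace.exp_continuous.comp (by fun_prop)

theorem Matrix.exp_add_smul (A : Matrix (Fin n) (Fin n) ℝ) (s t : ℝ) :
    NormedSpace.exp ((s + t) • A) = NormedSpace.exp (s • A) * NormedSpace.exp (t • A) := by
  rw [add_smul]
  exact Matrix.exp_add_of_commute _ _ (((Commute.refl A).smul_left _).smul_right _)

theorem Matrix.hasDerivAt_mul_exp_smul_mul {p q : Type*} [Fintype p] [Fintype q]
    (A : Matrix (Fin n) (Fin n) ℝ) (P : Matrix p (Fin n) ℝ) (Q : Matrix (Fin n) q ℝ)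
    (i : p) (j : q) (t : ℝ) :
    HasDerivAt (fun s : ℝ => (P * NormedSpace.exp (s • A) * Q) i j)
      ((P * A * NormedSpace.exp (t • A) * Q) i j) t := by
  have h := hasDerivAt_exp_smul_const' (𝕂 := ℝ) A t
  let L : Matrix (Fin n) (Fin n) ℝ →ₗ[ℝ] ℝ :=
    { toFun := fun M => (P * M * Q) i j
      map_add' := fun M N => by simp [Matrix.mul_add, Matrix.add_mul]
      map_smul' := fun c M => by simp }
  have h2 := (L.toContinuousLinearMap.hasFDerivAt).comp_hasDerivAt t h
  have h3 : P * (A * NormedSpace.exp (t • A)) * Q = P * A * NormedSpace.exp (t • A) * Q := by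
    rw [← Matrix.mul_assoc P]
  rw [← h3]
  exact h2

/-- The Taylor expansion of `t ↦ P e^{tA} Q` about the point `s`. -/
theorem Matrix.hasSum_mul_exp_smul_mul {p q : Type*} [Fintype p] [Fintype q]
    (A : Matrix (Fin n) (Fin n) ℝ) (P : Matrix p (Fin n) ℝ) (Q : Matrix (Fin n) q ℝ)
    (i : p) (j : q) (s y : ℝ) :
    HasSum (fun k : ℕ => y ^ k * ((k.factorial : ℝ)⁻¹ *
        ((-1 : ℝ) ^ k * (P * A ^ k * NormedSpace.exp (s • A) * Q) i j)))
      ((P * NormedSpace.exp ((s - y) • A) * Q) i j) := by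
  have h := NormedSpace.exp_series_hasSum_exp' (𝕂 := ℝ) ((-y) • A)
  let L : Matrix (Fin n) (Fin n) ℝ →ₗ[ℝ] ℝ :=
    { toFun := fun M => (P * M * NormedSpace.exp (s • A) * Q) i j
      map_add' := fun M N => by simp [Matrix.mul_add, Matrix.add_mul]
      map_smul' := fun c M => by simp }
  have h2 := h.map L.toContinuousLinearMap L.toContinuousLinearMap.continuous
  have h3 : P * NormedSpace.exp ((-y) • A) * NormedSpace.exp (s • A) * Q =
      P * NormedSpace.exp ((s - y) • A) * Q := by
    rw [Matrix.mul_assoc P, ← Matrix.exp_add_smul, neg_add_eq_sub]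
  have h4 : L.toContinuousLinearMap (NormedSpace.exp ((-y) • A)) =
      (P * NormedSpace.exp ((s - y) • A) * Q) i j := by
    rw [← h3]; rfl
  have h5 : ∀ k : ℕ, L.toContinuousLinearMap ((k.factorial : ℝ)⁻¹ • ((-y) • A) ^ k) =
      y ^ k * ((k.factorial : ℝ)⁻¹ *
        ((-1 : ℝ) ^ k * (P * A ^ k * NormedSpace.exp (s • A) * Q) i j)) := by
    intro k
    rw [smul_pow, map_smul, map_smul, neg_pow y k, smul_eq_mul, smul_eq_mul]
    have h6 : L.toContinuousLinearMap (A ^ k) =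
      (P * A ^ k * NormedSpace.exp (s • A) * Q) i j := rfl
    rw [h6]
    ring
  rw [← h4]
  simp only [← h5]
  exact h2

end MatrixExp

/-! ### Kernels `K (s + t)` of positive type and alternating derivatives. -/

section HankelPositivity

variable {m : ℕ}

/-- A matrix-valued function `K` on `[0, ∞)` is Hankel positive if the kernel
`(s, t) ↦ K (s + t)` is of positive type. -/
def IsHankelPositive (K : ℝ → Matrix (Fin m) (Fin m) ℝ) : Prop :=
  ∀ (ι : Type) [Fintype ι] (t : ι → ℝ) (v : ι → Fin m → ℝ), (∀ a, 0 ≤ t a) →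
    0 ≤ ∑ a, ∑ b, v a ⬝ᵥ K (t a + t b) *ᵥ v b

theorem Matrix.dotProduct_mulVec_eq_sum (M : Matrix (Fin m) (Fin m) ℝ) (v w : Fin m → ℝ) :
    v ⬝ᵥ M *ᵥ w = ∑ i, ∑ j, v i * (M i j * w j) := by
  simp [dotProduct, Matrix.mulVec, Finset.mul_sum]

theorem Matrix.tendsto_dotProduct_mulVec {K : ℝ → Matrix (Fin m) (Fin m) ℝ}
    {l : Filter ℝ} (h : ∀ i j, Filter.Tendsto (fun t => K t i j) l (nhds 0)) (v w : Fin m → ℝ) :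
    Filter.Tendsto (fun t => v ⬝ᵥ K t *ᵥ w) l (nhds 0) := by
  simp only [Matrix.dotProduct_mulVec_eq_sum]
  have h1 : Filter.Tendsto (fun t => ∑ i, ∑ j, v i * (K t i j * w j)) l
      (nhds (∑ i : Fin m, ∑ j : Fin m, v i * (0 * w j))) :=
    tendsto_finsetSum _ fun i _ => tendsto_finsetSum _ fun j _ =>
      ((h i j).mul_const _).const_mul _
  simpa using h1

theorem Matrix.hasDerivAt_dotProduct_mulVec {K : ℝ → Matrix (Fin m) (Fin m) ℝ}
    {K' : Matrix (Fin m) (Fin m) ℝ} {t : ℝ} (h : ∀ i j, HasDerivAt (fun s => K s i j) (K' i j) t)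
    (v w : Fin m → ℝ) : HasDerivAt (fun s => v ⬝ᵥ K s *ᵥ w) (v ⬝ᵥ K' *ᵥ w) t := by
  simp only [Matrix.dotProduct_mulVec_eq_sum]
  exact HasDerivAt.fun_sum fun i _ => HasDerivAt.fun_sum fun j _ =>
    ((h i j).mul_const _).const_mul _

/-- Midpoint convexity in the shift: positivity is tested on the points `t a + x / 2` with vectors
`v a`, together with `t a + x / 2 + h` with vectors `-v a`. -/
theorem IsHankelPositive.two_mul_le {K : ℝ → Matrix (Fin m) (Fin m) ℝ} (hK : IsHankelPositive K)
    {ι : Type} [Fintype ι] {t : ι → ℝ} (v : ι → Fin m → ℝ) (ht : ∀ a, 0 ≤ t a) {x h : ℝ}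
    (hx : 0 ≤ x) (hh : 0 ≤ h) :
    2 * ∑ a, ∑ b, v a ⬝ᵥ K (t a + t b + (x + h)) *ᵥ v b ≤
      ∑ a, ∑ b, v a ⬝ᵥ K (t a + t b + x) *ᵥ v b +
        ∑ a, ∑ b, v a ⬝ᵥ K (t a + t b + (x + 2 * h)) *ᵥ v b := by
  have h0 := hK (ι ⊕ ι) (Sum.elim (fun a => t a + x / 2) fun a => t a + x / 2 + h)
    (Sum.elim v fun a => -v a) (by
      rintro (a | a)
      · have := ht a
        simp only [Sum.elim_inl]
        positivity
      · have := ht a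
        simp only [Sum.elim_inr]
        positivity)
  simp only [Fintype.sum_sum_type, Sum.elim_inl, Sum.elim_inr, Matrix.mulVec_neg, dotProduct_neg,
    neg_dotProduct, Finset.sum_neg_distrib, Finset.sum_add_distrib] at h0
  have e1 : ∀ a b, t a + x / 2 + (t b + x / 2) = t a + t b + x := fun a b => by ring
  have e2 : ∀ a b, t a + x / 2 + (t b + x / 2 + h) = t a + t b + (x + h) := fun a b => by ring
  have e3 : ∀ a b, t a + x / 2 + h + (t b + x / 2) = t a + t b + (x + h) := fun a b => by ring
  have e4 : ∀ a b, t a + x / 2 + h + (t b + x / 2 + h) = t a + t b + (x + 2 * h) :=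
    fun a b => by ring
  simp only [e1, e2, e3, e4] at h0
  linarith

theorem IsHankelPositive.sum_shift_le {K : ℝ → Matrix (Fin m) (Fin m) ℝ} (hK : IsHankelPositive K)
    (hlim : ∀ i j, Filter.Tendsto (fun t => K t i j) Filter.atTop (nhds 0))
    {ι : Type} [Fintype ι] {t : ι → ℝ} (v : ι → Fin m → ℝ) (ht : ∀ a, 0 ≤ t a) {h : ℝ}
    (hh : 0 < h) :
    ∑ a, ∑ b, v a ⬝ᵥ K (t a + t b + h) *ᵥ v b ≤ ∑ a, ∑ b, v a ⬝ᵥ K (t a + t b) *ᵥ v b := by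
  set φ : ℝ → ℝ := fun s => ∑ a, ∑ b, v a ⬝ᵥ K (t a + t b + s) *ᵥ v b with hφ
  have hφlim : Filter.Tendsto φ Filter.atTop (nhds 0) := by
    have h1 : Filter.Tendsto φ Filter.atTop (nhds (∑ _a : ι, ∑ _b : ι, (0 : ℝ))) :=
      tendsto_finsetSum _ fun a _ => tendsto_finsetSum _ fun b _ =>
        (Matrix.tendsto_dotProduct_mulVec hlim _ _).comp
          (Filter.tendsto_atTop_add_const_left _ _ Filter.tendsto_id)
    simpa using h1
  -- By convexity the increments of `φ` are nondecreasing; since `φ → 0` they tend to `0`, so the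
  -- first one is nonpositive.
  have hstep : ∀ k : ℕ, φ h - φ 0 ≤ φ ((k + 1 : ℕ) * h) - φ (k * h) := by
    intro k
    induction k with
    | zero => simp
    | succ k ih =>
      refine ih.trans ?_
      have h1 := hK.two_mul_le v ht (x := k * h) (h := h) (by positivity) hh.le
      have h2 : 2 * φ (k * h + h) ≤ φ (k * h) + φ (k * h + 2 * h) := h1
      have e1 : ((k + 1 : ℕ) : ℝ) * h = k * h + h := by push_cast; ring
      have e2 : ((k + 1 + 1 : ℕ) : ℝ) * h = k * h + 2 * h := by push_cast; ring
      rw [e1, e2]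
      linarith
  have hmul : Filter.Tendsto (fun k : ℕ => (k : ℝ) * h) Filter.atTop Filter.atTop :=
    tendsto_natCast_atTop_atTop.atTop_mul_const hh
  have h1 := hφlim.comp hmul
  have h2 := (h1.comp (Filter.tendsto_add_atTop_nat 1)).sub h1
  rw [sub_zero] at h2
  have h3 := ge_of_tendsto' h2 hstep
  have h4 : φ 0 = ∑ a, ∑ b, v a ⬝ᵥ K (t a + t b) *ᵥ v b := by simp [hφ]
  rw [← h4]
  show φ h ≤ φ 0
  linarith

/-- A small shift does not increase the quadratic sum, so its right derivative at shift `0` is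
nonpositive. -/
theorem IsHankelPositive.neg_deriv {K K' : ℝ → Matrix (Fin m) (Fin m) ℝ} (hK : IsHankelPositive K)
    (hlim : ∀ i j, Filter.Tendsto (fun t => K t i j) Filter.atTop (nhds 0))
    (hderiv : ∀ t i j, HasDerivAt (fun s => K s i j) (K' t i j) t) :
    IsHankelPositive fun t => -K' t := by
  intro ι _ t v ht
  have hd : HasDerivAt (fun s => ∑ a, ∑ b, v a ⬝ᵥ K (t a + t b + s) *ᵥ v b)
      (∑ a, ∑ b, v a ⬝ᵥ K' (t a + t b) *ᵥ v b) 0 := by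
    refine HasDerivAt.fun_sum fun a _ => HasDerivAt.fun_sum fun b _ => ?_
    refine HasDerivAt.comp_const_add (t a + t b) 0 (f := fun s => v a ⬝ᵥ K s *ᵥ v b) ?_
    rw [add_zero]
    exact Matrix.hasDerivAt_dotProduct_mulVec (hderiv _) _ _
  have hle := le_of_tendsto hd.tendsto_slope_zero_right (b := 0) (by
    filter_upwards [self_mem_nhdsWithin] with s hs
    have h1 := hK.sum_shift_le hlim v ht hs
    have h2 : 0 ≤ s⁻¹ := inv_nonneg.2 (le_of_lt hs)
    simp only [zero_add, add_zero, smul_eq_mul]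
    exact mul_nonpos_of_nonneg_of_nonpos h2 (by linarith))
  simp only [Matrix.neg_mulVec, dotProduct_neg, Finset.sum_neg_distrib]
  linarith

theorem Matrix.PosSemidef.abs_dotProduct_mulVec_le {M : Matrix (Fin m) (Fin m) ℝ}
    (hM : M.PosSemidef) (v w : Fin m → ℝ) :
    |v ⬝ᵥ M *ᵥ w| ≤ (v ⬝ᵥ M *ᵥ v + w ⬝ᵥ M *ᵥ w) / 2 := by
  have hsymm : w ⬝ᵥ M *ᵥ v = v ⬝ᵥ M *ᵥ w := by
    have h : Mᵀ = M := by simpa [Matrix.IsHermitian] using hM.isHermitian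
    rw [Matrix.dotProduct_mulVec, ← Matrix.mulVec_transpose, h, dotProduct_comm]
  have h1 := hM.dotProduct_mulVec_nonneg (v + w)
  have h2 := hM.dotProduct_mulVec_nonneg (v - w)
  simp only [star_trivial, Matrix.mulVec_add, Matrix.mulVec_sub, dotProduct_add, add_dotProduct,
    dotProduct_sub, sub_dotProduct, hsymm] at h1 h2
  rw [abs_le]
  constructor <;> linarith

/-- The bases differ by `a * b`, and factoring the difference of powers leaves at most the geometric
sum of `(1 - a) ^ j` for `j < k`. The resulting bound by `b` is uniform in `k`. -/
theorem pow_one_sub_sub_le {a b : ℝ} (ha : 0 ≤ a) (hb : 0 ≤ b) (hab : a + b ≤ 1) (k : ℕ) :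
    ((1 - a) * (1 - b)) ^ k - (1 - (a + b)) ^ k ≤ b * (1 - (1 - a) ^ k) := by
  induction k with
  | zero => simp
  | succ k ih =>
    have hr0 : 0 ≤ 1 - (a + b) := by linarith
    have ha1 : 0 ≤ 1 - a := by linarith
    have hb1 : 0 ≤ 1 - b := by linarith
    have hp0 : 0 ≤ (1 - a) ^ k := pow_nonneg ha1 k
    have hp1 : (1 - a) ^ k ≤ 1 := pow_le_one₀ ha1 (by linarith)
    have h1 : (1 - (a + b)) ^ k ≤ (1 - a) ^ k := pow_le_pow_left₀ hr0 (by linarith) k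
    have h2 : ((1 - a) * (1 - b)) * (((1 - a) * (1 - b)) ^ k - (1 - (a + b)) ^ k) ≤
        ((1 - a) * (1 - b)) * (b * (1 - (1 - a) ^ k)) :=
      mul_le_mul_of_nonneg_left ih (mul_nonneg ha1 hb1)
    have h3 : ((1 - a) * (1 - b)) * (b * (1 - (1 - a) ^ k)) ≤
        (1 - a) * (b * (1 - (1 - a) ^ k)) := by
      refine mul_le_mul_of_nonneg_right ?_ (mul_nonneg hb (by linarith))
      exact mul_le_of_le_one_right ha1 (by linarith)
    have h4 : (a * b) * (1 - (a + b)) ^ k ≤ (a * b) * (1 - a) ^ k :=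
      mul_le_mul_of_nonneg_left h1 (mul_nonneg ha hb)
    have h5 : (a * b) * (1 - a) ^ k ≤ (a * b) * 1 :=
      mul_le_mul_of_nonneg_left hp1 (mul_nonneg ha hb)
    rw [pow_succ, pow_succ, pow_succ]
    nlinarith

theorem abs_pow_one_sub_sub_le {a b : ℝ} (ha : 0 ≤ a) (hb : 0 ≤ b) (hab : a + b ≤ 1) (k : ℕ) :
    |(1 - (a + b)) ^ k - ((1 - a) * (1 - b)) ^ k| ≤ b := by
  have h1 := pow_one_sub_sub_le ha hb hab k
  have hp0 : 0 ≤ (1 - a) ^ k := pow_nonneg (by linarith) k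
  have h2 : (1 - (a + b)) ^ k ≤ ((1 - a) * (1 - b)) ^ k :=
    pow_le_pow_left₀ (by linarith) (by nlinarith) k
  rw [abs_le]
  constructor
  · nlinarith
  · linarith

/-- The product weights `(1 - x a) ^ k * (1 - x b) ^ k` give the quadratic form of `M` at `∑ a, (1 -
x a) ^ k • v a`, which is nonnegative. Replacing them by the actual weights costs at most `δ` per
pair, whatever `k`. -/
theorem Matrix.PosSemidef.neg_le_sum_pow_one_sub {M : Matrix (Fin m) (Fin m) ℝ}
    (hM : M.PosSemidef) {ι : Type*} [Fintype ι] {x : ι → ℝ} (v : ι → Fin m → ℝ) {δ : ℝ}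
    (hx : ∀ a, 0 ≤ x a) (hxδ : ∀ a, x a ≤ δ) (hδ0 : 0 ≤ δ) (hδ : 2 * δ ≤ 1) (k : ℕ) :
    -(δ * ∑ a, ∑ b, (v a ⬝ᵥ M *ᵥ v a + v b ⬝ᵥ M *ᵥ v b) / 2) ≤
      ∑ a, ∑ b, (1 - (x a + x b)) ^ k * (v a ⬝ᵥ M *ᵥ v b) := by
  have hprod : 0 ≤ ∑ a, ∑ b, ((1 - x a) * (1 - x b)) ^ k * (v a ⬝ᵥ M *ᵥ v b) := by
    have h1 := hM.dotProduct_mulVec_nonneg (∑ a, (1 - x a) ^ k • v a)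
    rw [star_trivial, Matrix.mulVec_sum, sum_dotProduct] at h1
    simp only [dotProduct_sum, Matrix.mulVec_smul, dotProduct_smul, smul_dotProduct,
      smul_eq_mul] at h1
    refine h1.trans_eq (Finset.sum_congr rfl fun a _ => Finset.sum_congr rfl fun b _ => ?_)
    rw [mul_pow]
    ring
  have hdiff : ∀ a b, -(δ * ((v a ⬝ᵥ M *ᵥ v a + v b ⬝ᵥ M *ᵥ v b) / 2)) ≤
      (1 - (x a + x b)) ^ k * (v a ⬝ᵥ M *ᵥ v b) -
        ((1 - x a) * (1 - x b)) ^ k * (v a ⬝ᵥ M *ᵥ v b) := by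
    intro a b
    have h3 : |(1 - (x a + x b)) ^ k - ((1 - x a) * (1 - x b)) ^ k| ≤ δ :=
      (abs_pow_one_sub_sub_le (hx a) (hx b) (by linarith [hxδ a, hxδ b]) k).trans (hxδ b)
    have h4 := mul_le_mul h3 (hM.abs_dotProduct_mulVec_le (v a) (v b)) (abs_nonneg _) hδ0
    rw [← abs_mul] at h4
    rw [← sub_mul]
    exact (abs_le.1 h4).1
  have hsumdiff := Finset.sum_le_sum fun a (_ : a ∈ Finset.univ) =>
    Finset.sum_le_sum fun b (_ : b ∈ Finset.univ) => hdiff a b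
  simp only [Finset.sum_neg_distrib, Finset.sum_sub_distrib, ← Finset.mul_sum] at hsumdiff
  linarith

/-- A function whose Taylor coefficients at every point of `[0, ∞)` alternate in sign is Hankel
positive. Expanding at `s`, the kernel `(1 - (t + t') / s) ^ k` is compared with the product kernel
`(1 - t / s) ^ k * (1 - t' / s) ^ k`, and `s` tends to infinity. -/
theorem isHankelPositive_of_hasSum {D : ℕ → ℝ → Matrix (Fin m) (Fin m) ℝ}
    (hD : ∀ k t, 0 ≤ t → (D k t).PosSemidef)
    (hsum : ∀ s y i j, HasSum (fun k : ℕ => y ^ k * ((k.factorial : ℝ)⁻¹ * D k s i j))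
      (D 0 (s - y) i j)) :
    IsHankelPositive (D 0) := by
  intro ι _ t v ht
  set T : ℝ := ∑ a, t a with hT
  have hT0 : 0 ≤ T := Finset.sum_nonneg fun a _ => ht a
  have htT : ∀ a, t a ≤ T := fun a => Finset.single_le_sum (fun a _ => ht a) (Finset.mem_univ a)
  set E : ℝ := ∑ a, ∑ b, (v a ⬝ᵥ D 0 0 *ᵥ v a + v b ⬝ᵥ D 0 0 *ᵥ v b) / 2 with hE
  have hquad : ∀ (s y : ℝ) (x z : Fin m → ℝ),
      HasSum (fun k : ℕ => y ^ k * ((k.factorial : ℝ)⁻¹ * (x ⬝ᵥ D k s *ᵥ z)))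
        (x ⬝ᵥ D 0 (s - y) *ᵥ z) := by
    intro s y x z
    simp only [Matrix.dotProduct_mulVec_eq_sum]
    have h1 : HasSum (fun k : ℕ => ∑ i, ∑ j, x i * ((y ^ k * ((k.factorial : ℝ)⁻¹ * D k s i j)) *
        z j)) (∑ i, ∑ j, x i * (D 0 (s - y) i j * z j)) :=
      hasSum_sum fun i _ => hasSum_sum fun j _ => ((hsum s y i j).mul_right _).mul_left _
    convert h1 using 2 with k
    simp only [Finset.mul_sum]
    exact Finset.sum_congr rfl fun i _ => Finset.sum_congr rfl fun j _ => by ring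
  have hbound : ∀ s : ℝ, 2 * T + 1 ≤ s →
      -(T / s * E) ≤ ∑ a, ∑ b, v a ⬝ᵥ D 0 (t a + t b) *ᵥ v b := by
    intro s hs
    have hs0 : 0 < s := by linarith
    have hquad' : ∀ (y : ℝ) (k : ℕ) (x z : Fin m → ℝ), y ^ k * (x ⬝ᵥ
        ((s ^ k * (k.factorial : ℝ)⁻¹) • D k s) *ᵥ z) =
        (y * s) ^ k * ((k.factorial : ℝ)⁻¹ * (x ⬝ᵥ D k s *ᵥ z)) := by
      intro y k x z
      rw [Matrix.smul_mulVec, dotProduct_smul, smul_eq_mul, mul_pow]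
      ring
    -- Taylor expansion at `s` with increment `y = s - (t a + t b)`; the factor `s ^ k` is moved
    -- into the positive semidefinite matrix `(s ^ k / k!) • D k s`.
    have hw1 : HasSum (fun k : ℕ => ∑ a, ∑ b, (1 - (t a / s + t b / s)) ^ k *
        (v a ⬝ᵥ ((s ^ k * (k.factorial : ℝ)⁻¹) • D k s) *ᵥ v b))
        (∑ a, ∑ b, v a ⬝ᵥ D 0 (t a + t b) *ᵥ v b) := by
      refine hasSum_sum fun a _ => hasSum_sum fun b _ => ?_
      have h1 := hquad s (s - (t a + t b)) (v a) (v b)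
      have h2 : (1 - (t a / s + t b / s)) * s = s - (t a + t b) := by field_simp
      rw [sub_sub_cancel, ← h2] at h1
      simpa only [hquad'] using h1
    -- With `y = s` the same matrices sum to `D 0 0`, so the errors over all `k` add up to `T / s *
    -- E`, which vanishes as `s → ∞`.
    have hw2 : HasSum (fun k : ℕ => -(T / s * ∑ a, ∑ b,
        (v a ⬝ᵥ ((s ^ k * (k.factorial : ℝ)⁻¹) • D k s) *ᵥ v a +
          v b ⬝ᵥ ((s ^ k * (k.factorial : ℝ)⁻¹) • D k s) *ᵥ v b) / 2)) (-(T / s * E)) := by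
      have h1 : ∀ a, HasSum (fun k : ℕ =>
          v a ⬝ᵥ ((s ^ k * (k.factorial : ℝ)⁻¹) • D k s) *ᵥ v a) (v a ⬝ᵥ D 0 0 *ᵥ v a) := by
        intro a
        have h1 := hquad s s (v a) (v a)
        rw [sub_self] at h1
        simpa only [Matrix.smul_mulVec, dotProduct_smul, smul_eq_mul, mul_assoc] using h1
      have h2 := hasSum_sum fun a (_ : a ∈ Finset.univ) =>
        hasSum_sum fun b (_ : b ∈ Finset.univ) => ((h1 a).add (h1 b)).div_const 2
      exact (h2.mul_left (T / s)).neg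
    refine hasSum_le (fun k => ?_) hw2 hw1
    refine ((hD k s hs0.le).smul (by positivity)).neg_le_sum_pow_one_sub v
      (fun a => div_nonneg (ht a) hs0.le) (fun a => div_le_div_of_nonneg_right (htT a) hs0.le)
      (by positivity) ?_ k
    rw [← mul_div_assoc, div_le_one hs0]
    linarith
  have hlim : Filter.Tendsto (fun s : ℝ => -(T / s * E)) Filter.atTop (nhds 0) := by
    have h1 := ((tendsto_const_nhds (x := T)).div_atTop Filter.tendsto_id).mul_const E |>.neg
    simpa using h1
  exact le_of_tendsto hlim (Filter.eventually_atTop.2 ⟨2 * T + 1, hbound⟩)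

end HankelPositivity

/-! ### Complete monotonicity of the impulse response. -/

namespace LTISystem

variable {n m p : ℕ}

/-- The system with output matrix `C A ^ k`; its impulse response is the `k`-th derivative of
`g`. -/
def derivSystem (S : LTISystem n m p) (k : ℕ) : LTISystem n m p :=
  { S with C := S.C * S.A ^ k }

theorem derivSystem_zero (S : LTISystem n m p) : S.derivSystem 0 = S := by
  simp [derivSystem]

theorem hasDerivAt_g_apply (S : LTISystem n m p) (k : ℕ) (i : Fin p) (j : Fin m) (t : ℝ) :
    HasDerivAt (fun s => (S.derivSystem k).g s i j) ((S.derivSystem (k + 1)).g t i j) t := by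
  have h := Matrix.hasDerivAt_mul_exp_smul_mul S.A (S.C * S.A ^ k) S.B i j t
  rw [Matrix.mul_assoc S.C, ← pow_succ] at h
  exact h

theorem hasSum_g_apply (S : LTISystem n m p) (s y : ℝ) (i : Fin p) (j : Fin m) :
    HasSum (fun k : ℕ => y ^ k * ((k.factorial : ℝ)⁻¹ *
      ((-1 : ℝ) ^ k * (S.derivSystem k).g s i j))) (S.g (s - y) i j) :=
  Matrix.hasSum_mul_exp_smul_mul S.A S.C S.B i j s y

theorem iteratedDeriv_g_apply (S : LTISystem n m p) (k : ℕ) (i : Fin p) (j : Fin m) :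
    iteratedDeriv k (fun s => S.g s i j) = fun s => (S.derivSystem k).g s i j := by
  induction k with
  | zero => rw [iteratedDeriv_zero, derivSystem_zero]
  | succ k ih =>
    rw [iteratedDeriv_succ, ih]
    exact funext fun t => (S.hasDerivAt_g_apply k i j t).deriv

theorem contDiff_g_apply (S : LTISystem n m p) (i : Fin p) (j : Fin m) :
    ContDiff ℝ ∞ fun s => S.g s i j := by
  refine contDiff_of_differentiable_iteratedDeriv fun k _ => ?_
  rw [iteratedDeriv_g_apply]
  exact fun t => (S.hasDerivAt_g_apply k i j t).differentiableAt

theorem iteratedDerivWithin_g_apply (S : LTISystem n m p) (k : ℕ) (i : Fin p) (j : Fin m) {t : ℝ}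
    (ht : 0 ≤ t) :
    iteratedDerivWithin k (fun s => S.g s i j) (Set.Ici 0) t = (S.derivSystem k).g t i j := by
  have h : ContDiffAt ℝ k (fun s => S.g s i j) t :=
    ((S.contDiff_g_apply i j).of_le (by exact_mod_cast le_top)).contDiffAt
  rw [iteratedDerivWithin_eq_iteratedDeriv (uniqueDiffOn_Ici 0) h ht, iteratedDeriv_g_apply]

theorem exists_abs_g_le (S : LTISystem n m p) (hA : IsHurwitz S.A) :
    ∃ M α : ℝ, 0 < α ∧ ∀ t : ℝ, 0 ≤ t → ∀ i j, |S.g t i j| ≤ M * Real.exp (-α * t) := by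
  obtain ⟨M, α, hα, h⟩ := hA.exists_abs_exp_le
  set c : Fin p → Fin m → ℝ := fun i j => ∑ b, (∑ a, |S.C i a| * M) * |S.B b j| with hc
  have hbound : ∀ t : ℝ, 0 ≤ t → ∀ i j, |S.g t i j| ≤ c i j * Real.exp (-α * t) := by
    intro t ht i j
    simp only [g, Matrix.mul_apply, hc, Finset.sum_mul]
    refine (Finset.abs_sum_le_sum_abs _ _).trans (Finset.sum_le_sum fun b _ => ?_)
    refine (Finset.abs_sum_le_sum_abs _ _).trans (Finset.sum_le_sum fun a _ => ?_)
    rw [abs_mul, abs_mul]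
    calc |S.C i a| * |NormedSpace.exp (t • S.A) a b| * |S.B b j| ≤
        |S.C i a| * (M * Real.exp (-α * t)) * |S.B b j| := by
          gcongr
          exact h t ht a b
      _ = _ := by ring
  have hc0 : ∀ i j, 0 ≤ c i j := fun i j => by
    have := (abs_nonneg _).trans (hbound 0 le_rfl i j)
    simpa using this
  refine ⟨∑ i, ∑ j, c i j, α, hα, fun t ht i j => (hbound t ht i j).trans ?_⟩
  refine mul_le_mul_of_nonneg_right ?_ (Real.exp_pos _).le
  exact (Finset.single_le_sum (f := c i) (fun j _ => hc0 i j) (Finset.mem_univ j)).trans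
    (Finset.single_le_sum (f := fun i => ∑ j, c i j)
      (fun i _ => Finset.sum_nonneg fun j _ => hc0 i j) (Finset.mem_univ i))

theorem tendsto_g_apply (S : LTISystem n m p) (hA : IsHurwitz S.A) (i : Fin p) (j : Fin m) :
    Filter.Tendsto (fun t => S.g t i j) Filter.atTop (nhds 0) := by
  obtain ⟨M, α, hα, h⟩ := S.exists_abs_g_le hA
  have hlim : Filter.Tendsto (fun t : ℝ => M * Real.exp (-α * t)) Filter.atTop (nhds 0) := by
    have h1 : Filter.Tendsto (fun t : ℝ => -α * t) Filter.atTop Filter.atBot :=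
      Filter.tendsto_id.const_mul_atTop_of_neg (by linarith)
    simpa using (Real.tendsto_exp_atBot.comp h1).const_mul M
  refine squeeze_zero_norm' ?_ hlim
  filter_upwards [Filter.eventually_ge_atTop 0] with t ht
  exact h t ht i j

theorem isCompletelyMonotonic_g_iff (S : LTISystem n m m) :
    IsCompletelyMonotonic S.g ↔ (∀ t, 0 ≤ t → S.g t = (S.g t)ᵀ) ∧
      ∀ k : ℕ, 1 ≤ k → ∀ t, 0 ≤ t → ((-1 : ℝ) ^ k • (S.derivSystem k).g t).PosSemidef := by
  have h : ∀ (k : ℕ) (t : ℝ), 0 ≤ t → (Matrix.of fun i j =>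
      iteratedDerivWithin k (fun s => S.g s i j) (Set.Ici 0) t) = (S.derivSystem k).g t :=
    fun k t ht => Matrix.ext fun i j => S.iteratedDerivWithin_g_apply k i j ht
  constructor
  · rintro ⟨-, h1, h2⟩
    refine ⟨h1, fun k hk t ht => ?_⟩
    rw [← h k t ht]
    exact h2 k hk t ht
  · rintro ⟨h1, h2⟩
    refine ⟨fun i j => (S.contDiff_g_apply i j).contDiffOn, h1, fun k hk t ht => ?_⟩
    rw [h k t ht]
    exact h2 k hk t ht

/-- This supplies the order `k = 0`: each `v ⬝ᵥ g v` is nonincreasing by the condition for `k = 1`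
and tends to `0`. -/
theorem posSemidef_g (S : LTISystem n m m) (hA : IsHurwitz S.A) (hg : IsCompletelyMonotonic S.g)
    {t : ℝ} (ht : 0 ≤ t) : (S.g t).PosSemidef := by
  obtain ⟨hsymm, hderiv⟩ := S.isCompletelyMonotonic_g_iff.1 hg
  refine Matrix.PosSemidef.of_dotProduct_mulVec_nonneg ?_ fun v => ?_
  · rw [Matrix.IsHermitian, Matrix.conjTranspose_eq_transpose_of_trivial]
    exact (hsymm t ht).symm
  rw [star_trivial]
  have hd : ∀ s, HasDerivAt (fun s => v ⬝ᵥ S.g s *ᵥ v) (v ⬝ᵥ (S.derivSystem 1).g s *ᵥ v) s := by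
    intro s
    refine Matrix.hasDerivAt_dotProduct_mulVec (fun i j => ?_) v v
    have h := S.hasDerivAt_g_apply 0 i j s
    rwa [derivSystem_zero] at h
  have hanti : AntitoneOn (fun s => v ⬝ᵥ S.g s *ᵥ v) (Set.Ici 0) := by
    refine antitoneOn_of_deriv_nonpos (convex_Ici 0)
      (fun s _ => (hd s).continuousAt.continuousWithinAt)
      (fun s _ => (hd s).differentiableAt.differentiableWithinAt) fun s hs => ?_
    rw [interior_Ici] at hs
    rw [(hd s).deriv]
    have h := (hderiv 1 le_rfl s (le_of_lt hs)).dotProduct_mulVec_nonneg v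
    simp only [pow_one, neg_smul, one_smul, star_trivial, Matrix.neg_mulVec, dotProduct_neg] at h
    linarith
  refine le_of_tendsto (Matrix.tendsto_dotProduct_mulVec (S.tendsto_g_apply hA) v v) ?_
  filter_upwards [Filter.eventually_ge_atTop t] with s hs
  exact hanti ht (ht.trans hs) hs

theorem isHankelPositive_g (S : LTISystem n m m) (hA : IsHurwitz S.A)
    (hg : IsCompletelyMonotonic S.g) : IsHankelPositive S.g := by
  have h := isHankelPositive_of_hasSum (D := fun k t => (-1 : ℝ) ^ k • (S.derivSystem k).g t)
    (fun k t ht => ?_) fun s y i j => ?_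
  · simpa [derivSystem_zero] using h
  · rcases Nat.eq_zero_or_pos k with rfl | hk
    · simpa [derivSystem_zero] using S.posSemidef_g hA hg ht
    · exact (S.isCompletelyMonotonic_g_iff.1 hg).2 k hk t ht
  · simpa [derivSystem_zero] using S.hasSum_g_apply s y i j

theorem isHankelPositive_derivSystem_g (S : LTISystem n m m) (hA : IsHurwitz S.A)
    (hg : IsHankelPositive S.g) (k : ℕ) :
    IsHankelPositive fun t => (-1 : ℝ) ^ k • (S.derivSystem k).g t := by
  induction k with
  | zero => simpa [derivSystem_zero] using hg
  | succ k ih =>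
    have h := ih.neg_deriv (K' := fun t => (-1 : ℝ) ^ k • (S.derivSystem (k + 1)).g t)
      (fun i j => by
        simpa using ((S.derivSystem k).tendsto_g_apply hA i j).const_mul ((-1 : ℝ) ^ k))
      (fun t i j => (S.hasDerivAt_g_apply k i j t).const_mul ((-1 : ℝ) ^ k))
    simpa [pow_succ] using h

theorem isCompletelyMonotonic_of_isHankelPositive (S : LTISystem n m m) (hA : IsHurwitz S.A)
    (hsymm : ∀ t, 0 ≤ t → S.g t = (S.g t)ᵀ) (hg : IsHankelPositive S.g) :
    IsCompletelyMonotonic S.g := by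
  refine S.isCompletelyMonotonic_g_iff.2 ⟨hsymm, fun k _ t ht => ?_⟩
  refine Matrix.PosSemidef.of_dotProduct_mulVec_nonneg ?_ fun v => ?_
  · rw [Matrix.IsHermitian, Matrix.conjTranspose_eq_transpose_of_trivial, Matrix.transpose_smul]
    congr 1
    ext i j
    rw [Matrix.transpose_apply, ← S.iteratedDerivWithin_g_apply k i j ht,
      ← S.iteratedDerivWithin_g_apply k j i ht]
    exact iteratedDerivWithin_congr (fun s hs => (congrFun (congrFun (hsymm s hs) i) j).symm) ht
  -- A single test point `t / 2` evaluates the kernel at `t`.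
  · have h := S.isHankelPositive_derivSystem_g hA hg k Unit (fun _ => t / 2) (fun _ => v)
      fun _ => by positivity
    simpa using h

theorem isCompletelyMonotonic_g_iff_isHankelPositive (S : LTISystem n m m) (hA : IsHurwitz S.A) :
    IsCompletelyMonotonic S.g ↔ (∀ t, 0 ≤ t → S.g t = (S.g t)ᵀ) ∧ IsHankelPositive S.g :=
  ⟨fun h => ⟨h.2.1, S.isHankelPositive_g hA h⟩,
    fun h => S.isCompletelyMonotonic_of_isHankelPositive hA h.1 h.2⟩

end LTISystem

/-! ### States reached by square-integrable signals. -/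

section MomentMap

variable {m : ℕ} {E : Type*} [NormedAddCommGroup E] [NormedSpace ℝ E]
  {κ : ℝ → (Fin m → ℝ) →ₗ[ℝ] E}

theorem integrable_apply_memLp
    (hκ : ∀ v, MemLp (fun t => κ t v) 2 (volume.restrict (Set.Ici (0 : ℝ))))
    {u : ℝ → EuclideanSpace ℝ (Fin m)} (hu : MemLp u 2 (volume.restrict (Set.Ici (0 : ℝ)))) :
    Integrable (fun t => κ t (u t).ofLp) (volume.restrict (Set.Ici (0 : ℝ))) := by
  have e : (fun t => κ t (u t).ofLp) = fun t => ∑ j, (u t).ofLp j •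
      κ t (fun i => if j = i then 1 else 0) :=
    funext fun t => LinearMap.pi_apply_eq_sum_univ (κ t) _
  rw [e]
  refine integrable_finsetSum _ fun j _ => ?_
  have hj : MemLp (fun t => (u t).ofLp j) 2 (volume.restrict (Set.Ici (0 : ℝ))) :=
    (EuclideanSpace.proj (𝕜 := ℝ) j).comp_memLp' hu
  exact memLp_one_iff_integrable.1 (MemLp.smul (hκ _) hj)

/-- The map `u ↦ ∫₀^∞ κ(t) u(t) dt` on square-integrable signals. -/
noncomputable def momentMap
    (hκ : ∀ v, MemLp (fun t => κ t v) 2 (volume.restrict (Set.Ici (0 : ℝ)))) :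
    L2Signal m →ₗ[ℝ] E where
  toFun u := ∫ t in Set.Ici (0 : ℝ), κ t (u t).ofLp
  map_add' u w := by
    rw [← integral_add (integrable_apply_memLp hκ (Lp.memLp u))
      (integrable_apply_memLp hκ (Lp.memLp w))]
    refine integral_congr_ae ?_
    filter_upwards [Lp.coeFn_add u w] with t ht
    rw [ht, Pi.add_apply, WithLp.ofLp_add, map_add]
  map_smul' c u := by
    rw [RingHom.id_apply, ← integral_smul]
    refine integral_congr_ae ?_
    filter_upwards [Lp.coeFn_smul c u] with t ht
    rw [ht, Pi.smul_apply, WithLp.ofLp_smul, map_smul]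

/-- Both subspaces of the finite-dimensional `E` have the same annihilator. If `f` kills the range,
the signal `s ↦ f (κ s e_j) e_j` shows that `∫ f (κ s e_j) ^ 2 = 0`. Thus impulses, which are not in
`L₂`, yield no state that signals cannot reach exactly. -/
theorem range_momentMap [FiniteDimensional ℝ E] (hcont : ∀ v, Continuous fun t => κ t v)
    (hκ : ∀ v, MemLp (fun t => κ t v) 2 (volume.restrict (Set.Ici (0 : ℝ)))) :
    LinearMap.range (momentMap hκ) =
      Submodule.span ℝ {x | ∃ t : ℝ, 0 ≤ t ∧ ∃ v, κ t v = x} := by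
  have : CompleteSpace E := FiniteDimensional.complete ℝ E
  refine Subspace.dualAnnihilator_inj.1 (Submodule.ext fun f => ?_)
  simp only [Submodule.mem_dualAnnihilator]
  set F : E →L[ℝ] ℝ := LinearMap.toContinuousLinearMap f with hF
  have hFapp : ∀ u : L2Signal m,
      f (momentMap hκ u) = ∫ t in Set.Ici (0 : ℝ), F (κ t (u t).ofLp) := fun u =>
    (F.integral_comp_comm (integrable_apply_memLp hκ (Lp.memLp u))).symm
  constructor
  · intro h
    suffices hker : Submodule.span ℝ {x | ∃ t : ℝ, 0 ≤ t ∧ ∃ v, κ t v = x} ≤ LinearMap.ker f from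
      fun w hw => hker hw
    refine Submodule.span_le.2 ?_
    rintro _ ⟨t, ht, v, rfl⟩
    have hcoord : ∀ j : Fin m, ∀ s ∈ Set.Ici (0 : ℝ), F (κ s (Pi.single j 1)) = 0 := by
      intro j
      have hfc : Continuous fun s => F (κ s (Pi.single j 1)) := F.continuous.comp (hcont _)
      have hfm : MemLp (fun s => F (κ s (Pi.single j 1))) 2
          (volume.restrict (Set.Ici (0 : ℝ))) := F.comp_memLp' (hκ _)
      have hum : MemLp (fun s => F (κ s (Pi.single j 1)) • EuclideanSpace.single j (1 : ℝ)) 2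
          (volume.restrict (Set.Ici (0 : ℝ))) :=
        (ContinuousLinearMap.toSpanSingleton ℝ (EuclideanSpace.single j (1 : ℝ))).comp_memLp' hfm
      have h0 := h _ ⟨hum.toLp, rfl⟩
      rw [hFapp] at h0
      have h1 : ∫ s in Set.Ici (0 : ℝ), F (κ s (Pi.single j 1)) ^ 2 = 0 := by
        refine Eq.trans (integral_congr_ae ?_) h0
        filter_upwards [hum.coeFn_toLp] with s hs
        have e : (F (κ s (Pi.single j 1)) • EuclideanSpace.single j (1 : ℝ)).ofLp =
            F (κ s (Pi.single j 1)) • (Pi.single j 1 : Fin m → ℝ) := by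
          ext i
          simp [Pi.single_apply]
        rw [hs, e, LinearMap.map_smul, ContinuousLinearMap.map_smul, smul_eq_mul, sq]
      rw [setIntegral_eq_zero_iff_of_nonneg_ae (Filter.Eventually.of_forall fun s => sq_nonneg _)
        ((memLp_two_iff_integrable_sq hfm.1).1 hfm)] at h1
      -- Continuity turns vanishing almost everywhere into vanishing on all of `[0, ∞)`, the
      -- endpoint `0` included.
      have h2 := Measure.eqOn_of_ae_eq h1 (hfc.pow 2).continuousOn continuousOn_const (by
        rw [interior_Ici, closure_Ioi])
      intro s hs
      exact pow_eq_zero_iff two_ne_zero |>.1 (h2 hs)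
    show F (κ t v) = 0
    rw [LinearMap.pi_apply_eq_sum_univ (κ t) v, map_sum]
    refine Finset.sum_eq_zero fun j _ => ?_
    have e : (fun i => if j = i then (1 : ℝ) else 0) = Pi.single j 1 := by
      ext i
      simp [Pi.single_apply, eq_comm]
    rw [map_smul, e, hcoord j t ht, smul_zero]
  · rintro h _ ⟨u, rfl⟩
    rw [hFapp]
    exact setIntegral_eq_zero_of_forall_eq_zero fun t ht =>
      h _ (Submodule.subset_span ⟨t, ht, _, rfl⟩)

end MomentMap

/-! ### The Hankel operator as a bilinear form on states. -/

theorem memLp_two_of_norm_le_exp {E : Type*} [NormedAddCommGroup E] {f : ℝ → E}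
    (hf : AEStronglyMeasurable f (volume.restrict (Set.Ici (0 : ℝ)))) {M α : ℝ} (hα : 0 < α)
    (hbound : ∀ t, 0 ≤ t → ‖f t‖ ≤ M * Real.exp (-α * t)) :
    MemLp f 2 (volume.restrict (Set.Ici (0 : ℝ))) := by
  have hexp : MemLp (fun t : ℝ => M * Real.exp (-α * t)) 2 (volume.restrict (Set.Ici (0 : ℝ))) := by
    refine MemLp.const_mul ?_ M
    rw [memLp_two_iff_integrable_sq (by fun_prop)]
    have h1 : (fun t : ℝ => Real.exp (-α * t) ^ 2) = fun t => Real.exp (-(2 * α) * t) := by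
      ext t
      rw [← Real.exp_nat_mul]
      congr 1
      push_cast
      ring
    rw [h1]
    exact (integrableOn_Ici_iff_integrableOn_Ioi (by simp)).2 (exp_neg_integrableOn_Ioi 0 (by positivity))
  refine hexp.of_le hf ?_
  filter_upwards [ae_restrict_mem measurableSet_Ici] with t ht
  exact (hbound t ht).trans (le_abs_self _)

/-- The duality pairing between the adjoint state and the state. -/
def stateForm (n : ℕ) : LinearMap.BilinForm ℝ ((Fin n → ℝ) × (Fin n → ℝ)) :=
  LinearMap.mk₂ ℝ (fun x y => x.1 ⬝ᵥ y.2)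
    (fun x y z => by simp [add_dotProduct]) (fun c x y => by simp [smul_dotProduct])
    (fun x y z => by simp [dotProduct_add]) (fun c x y => by simp [dotProduct_smul])

theorem stateForm_apply {n : ℕ} (x y : (Fin n → ℝ) × (Fin n → ℝ)) :
    stateForm n x y = x.1 ⬝ᵥ y.2 :=
  rfl

namespace LTISystem

variable {n m : ℕ}

theorem g_add (S : LTISystem n m m) (s t : ℝ) :
    S.g (s + t) = S.C * NormedSpace.exp (s • S.A) * (NormedSpace.exp (t • S.A) * S.B) := by
  rw [g, Matrix.exp_add_smul]
  simp only [Matrix.mul_assoc]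

/-- The adjoint state and the state that an impulse `v` at distance `t` from the origin
produces at the origin. -/
noncomputable def stateVec (S : LTISystem n m m) (t : ℝ) :
    (Fin m → ℝ) →ₗ[ℝ] (Fin n → ℝ) × (Fin n → ℝ) :=
  (Matrix.vecMulLinear (S.C * NormedSpace.exp (t • S.A))).prod
    (Matrix.mulVecLin (NormedSpace.exp (t • S.A) * S.B))

theorem stateVec_apply (S : LTISystem n m m) (t : ℝ) (v : Fin m → ℝ) :
    S.stateVec t v =
      (v ᵥ* (S.C * NormedSpace.exp (t • S.A)), (NormedSpace.exp (t • S.A) * S.B) *ᵥ v) :=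
  rfl

theorem stateForm_stateVec (S : LTISystem n m m) (s t : ℝ) (v w : Fin m → ℝ) :
    stateForm n (S.stateVec s v) (S.stateVec t w) = v ⬝ᵥ S.g (s + t) *ᵥ w := by
  rw [stateForm_apply, stateVec_apply, stateVec_apply, g_add, ← Matrix.dotProduct_mulVec,
    Matrix.mulVec_mulVec]

theorem continuous_stateVec (S : LTISystem n m m) (v : Fin m → ℝ) :
    Continuous fun t => S.stateVec t v := by
  have h := Matrix.continuous_exp_smul S.A
  have h1 : Continuous fun t : ℝ => S.C * NormedSpace.exp (t • S.A) :=
    continuous_const.matrix_mul h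
  have h2 : Continuous fun t : ℝ => NormedSpace.exp (t • S.A) * S.B :=
    h.matrix_mul continuous_const
  exact (continuous_const.matrix_vecMul h1).prodMk (h2.matrix_mulVec continuous_const)

theorem memLp_stateVec (S : LTISystem n m m) (hA : IsHurwitz S.A) (v : Fin m → ℝ) :
    MemLp (fun t => S.stateVec t v) 2 (volume.restrict (Set.Ici (0 : ℝ))) := by
  -- `C e^{tA}` and `e^{tA} B` are themselves impulse responses, with identity input or output
  -- matrix, so the decay estimate for `g` covers both.
  obtain ⟨M₁, α₁, hα₁, h₁⟩ := exists_abs_g_le (⟨S.A, 1, S.C, 0⟩ : LTISystem n n m) hA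
  obtain ⟨M₂, α₂, hα₂, h₂⟩ := exists_abs_g_le (⟨S.A, S.B, 1, 0⟩ : LTISystem n m n) hA
  simp only [g, Matrix.mul_one, Matrix.one_mul] at h₁ h₂
  have hexp : ∀ {α β t : ℝ}, 0 ≤ t → α ≤ β → Real.exp (-β * t) ≤ Real.exp (-α * t) :=
    fun ht hαβ => Real.exp_le_exp.2 (by nlinarith)
  have hsum : ∀ {q : ℕ} (f : Fin m → Fin q → ℝ) (M α t : ℝ) (a : Fin q), 0 ≤ t →
      min α₁ α₂ ≤ α → (∀ j, |f j a| ≤ M * Real.exp (-α * t)) →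
      |∑ j, v j * f j a| ≤ (∑ j, |v j|) * |M| * Real.exp (-(min α₁ α₂) * t) := by
    intro q f M α t a ht hα hf
    refine (Finset.abs_sum_le_sum_abs _ _).trans ?_
    rw [Finset.sum_mul, Finset.sum_mul]
    refine Finset.sum_le_sum fun j _ => ?_
    rw [abs_mul, mul_assoc]
    refine mul_le_mul_of_nonneg_left ((hf j).trans ?_) (abs_nonneg _)
    exact mul_le_mul (le_abs_self M) (hexp ht hα) (Real.exp_pos _).le (abs_nonneg _)
  refine memLp_two_of_norm_le_exp (M := (∑ j, |v j|) * |M₁| + (∑ j, |v j|) * |M₂|)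
    (α := min α₁ α₂) (S.continuous_stateVec v).aestronglyMeasurable (lt_min hα₁ hα₂)
    fun t ht => ?_
  have hn₁ : 0 ≤ (∑ j, |v j|) * |M₁| * Real.exp (-(min α₁ α₂) * t) :=
    mul_nonneg (mul_nonneg (Finset.sum_nonneg fun j _ => abs_nonneg _) (abs_nonneg _))
      (Real.exp_pos _).le
  have hn₂ : 0 ≤ (∑ j, |v j|) * |M₂| * Real.exp (-(min α₁ α₂) * t) :=
    mul_nonneg (mul_nonneg (Finset.sum_nonneg fun j _ => abs_nonneg _) (abs_nonneg _))
      (Real.exp_pos _).le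
  rw [add_mul, stateVec_apply, Prod.norm_def]
  refine max_le ?_ ?_
  · refine ((pi_norm_le_iff_of_nonneg hn₁).2 fun a => ?_).trans (le_add_of_nonneg_right hn₂)
    exact hsum (fun j a => (S.C * NormedSpace.exp (t • S.A)) j a) M₁ α₁ t a ht (min_le_left _ _)
      fun j => h₁ t ht j a
  · refine ((pi_norm_le_iff_of_nonneg hn₂).2 fun a => ?_).trans (le_add_of_nonneg_left hn₁)
    have h := hsum (fun j a => (NormedSpace.exp (t • S.A) * S.B) a j) M₂ α₂ t a ht
      (min_le_right _ _) fun j => h₂ t ht a j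
    simpa only [Matrix.mulVec, dotProduct, mul_comm, Real.norm_eq_abs] using h

/-- The output `C e^{tA} x` generated by the state component of `(z, x)`. -/
noncomputable def outputMap (S : LTISystem n m m) (t : ℝ) :
    (Fin n → ℝ) × (Fin n → ℝ) →L[ℝ] EuclideanSpace ℝ (Fin m) :=
  LinearMap.toContinuousLinearMap
    ((WithLp.linearEquiv 2 ℝ (Fin m → ℝ)).symm.toLinearMap ∘ₗ
      Matrix.mulVecLin (S.C * NormedSpace.exp (t • S.A)) ∘ₗ LinearMap.snd ℝ _ _)

theorem outputMap_apply (S : LTISystem n m m) (t : ℝ) (x : (Fin n → ℝ) × (Fin n → ℝ)) :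
    S.outputMap t x = WithLp.toLp 2 ((S.C * NormedSpace.exp (t • S.A)) *ᵥ x.2) :=
  rfl

theorem hankelIntegrand_eq (S : LTISystem n m m) (u : ℝ → EuclideanSpace ℝ (Fin m)) (t τ : ℝ) :
    S.hankelIntegrand u t τ = S.outputMap t (S.stateVec τ (u τ).ofLp) := by
  rw [hankelIntegrand, g_add, outputMap_apply, stateVec_apply, Matrix.mulVec_mulVec]

theorem inner_outputMap (S : LTISystem n m m) (t : ℝ) (x : (Fin n → ℝ) × (Fin n → ℝ))
    (w : EuclideanSpace ℝ (Fin m)) :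
    inner ℝ (S.outputMap t x) w = stateForm n (S.stateVec t w.ofLp) x := by
  rw [outputMap_apply, stateForm_apply, stateVec_apply, ← Matrix.dotProduct_mulVec,
    EuclideanSpace.inner_eq_star_dotProduct, star_trivial]

/-- The adjoint state and the state that a signal produces at the origin. -/
noncomputable def stateMap (S : LTISystem n m m) (hA : IsHurwitz S.A) :
    L2Signal m →ₗ[ℝ] (Fin n → ℝ) × (Fin n → ℝ) :=
  momentMap (S.memLp_stateVec hA)

/-- For `t > 0` the Dirac mass at `-t` lies outside `[0, ∞)`, so `D` matters only on a null set; the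
regular part depends on `u` only through its state. -/
theorem hankelFun_ae_eq (S : LTISystem n m m) (hA : IsHurwitz S.A) (u : L2Signal m) :
    S.hankelFun u =ᵐ[volume.restrict (Set.Ici (0 : ℝ))]
      fun t => S.outputMap t (S.stateMap hA u) := by
  have hne : ∀ᵐ t ∂(volume.restrict (Set.Ici (0 : ℝ))), t ≠ 0 :=
    ae_restrict_of_ae (Measure.ae_ne volume 0)
  filter_upwards [ae_restrict_mem measurableSet_Ici, hne] with t ht ht0
  have hpos : 0 < t := lt_of_le_of_ne ht (Ne.symm ht0)
  have hdirac : (Measure.dirac (-t)).restrict (Set.Ici (0 : ℝ)) = 0 := by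
    rw [Measure.restrict_eq_zero, Measure.dirac_apply' _ measurableSet_Ici]
    simp [hpos]
  rw [hankelFun, hdirac, integral_zero_measure, zero_add]
  simp only [hankelIntegrand_eq]
  exact (S.outputMap t).integral_comp_comm
    (integrable_apply_memLp (S.memLp_stateVec hA) (Lp.memLp u))

theorem memLp_outputMap (S : LTISystem n m m) (hA : IsHurwitz S.A)
    (x : (Fin n → ℝ) × (Fin n → ℝ)) :
    MemLp (fun t => S.outputMap t x) 2 (volume.restrict (Set.Ici (0 : ℝ))) := by
  -- Each output coordinate is a pairing of `x` with an adjoint state, so square integrability comes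
  -- from `memLp_stateVec`.
  have h : (fun t => S.outputMap t x) = fun t => ∑ i : Fin m,
      stateForm n (S.stateVec t (Pi.single i 1)) x • EuclideanSpace.single i (1 : ℝ) := by
    ext t i
    rw [outputMap_apply]
    simp [stateForm_apply, stateVec_apply, Matrix.mulVec, Pi.single_apply, Matrix.row]
  rw [h]
  refine memLp_finsetSum _ fun i _ => ?_
  have h1 := ((stateForm n).flip x).toContinuousLinearMap.comp_memLp'
    (S.memLp_stateVec hA (Pi.single i 1))
  exact (ContinuousLinearMap.toSpanSingleton ℝ (EuclideanSpace.single i (1 : ℝ))).comp_memLp' h1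

theorem hankelWellDefined (S : LTISystem n m m) (hA : IsHurwitz S.A) : S.HankelWellDefined := by
  refine fun u => ⟨fun t _ => ?_, ?_⟩
  · have h := (S.outputMap t).integrable_comp
      (integrable_apply_memLp (S.memLp_stateVec hA) (Lp.memLp u))
    refine h.congr (Filter.Eventually.of_forall fun τ => ?_)
    exact (S.hankelIntegrand_eq u t τ).symm
  · exact (memLp_congr_ae (S.hankelFun_ae_eq hA u)).2 (S.memLp_outputMap hA _)

/-- The inner integral collapses to the state of `u`; integrating the pairing against `w` then
collapses to the adjoint state of `w`. -/
theorem inner_hankel (S : LTISystem n m m) (hA : IsHurwitz S.A) (u w : L2Signal m) :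
    inner ℝ (S.hankel u) w = stateForm n (S.stateMap hA w) (S.stateMap hA u) := by
  have hu := (S.hankelWellDefined hA u).2
  have h1 : S.hankel u =ᵐ[volume.restrict (Set.Ici (0 : ℝ))]
      fun t => S.outputMap t (S.stateMap hA u) := by
    rw [hankel, dif_pos hu]
    exact hu.coeFn_toLp.trans (S.hankelFun_ae_eq hA u)
  have h2 := ((stateForm n).flip (S.stateMap hA u)).toContinuousLinearMap.integral_comp_comm
    (integrable_apply_memLp (S.memLp_stateVec hA) (Lp.memLp w))
  rw [L2.inner_def]
  refine Eq.trans (integral_congr_ae ?_) h2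
  filter_upwards [h1] with t ht
  rw [ht, inner_outputMap]
  rfl

/-- The Hankel operator as a linear map. -/
noncomputable def hankelLinearMap (S : LTISystem n m m) (hA : IsHurwitz S.A) :
    L2Signal m →ₗ[ℝ] L2Signal m where
  toFun := S.hankel
  -- Testing against every `w` reduces linearity of `hankel` to that of `stateMap`.
  map_add' u v := ext_inner_right ℝ fun w => by
    simp only [inner_add_left, S.inner_hankel hA, map_add]
  map_smul' c u := ext_inner_right ℝ fun w => by
    simp only [inner_smul_left, S.inner_hankel hA, map_smul, RingHom.id_apply,
      RCLike.conj_to_real, smul_eq_mul]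

theorem range_stateMap (S : LTISystem n m m) (hA : IsHurwitz S.A) :
    LinearMap.range (S.stateMap hA) =
      Submodule.span ℝ {x | ∃ t : ℝ, 0 ≤ t ∧ ∃ v, S.stateVec t v = x} :=
  range_momentMap S.continuous_stateVec (S.memLp_stateVec hA)

theorem isSelfAdjointOperator_hankel_iff (S : LTISystem n m m) (hA : IsHurwitz S.A) :
    IsSelfAdjointOperator S.hankel ↔ ∀ t, 0 ≤ t → S.g t = (S.g t)ᵀ := by
  constructor
  · intro h t ht
    have hmem : ∀ (s : ℝ) (v : Fin m → ℝ), 0 ≤ s →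
        ∃ u, S.stateMap hA u = S.stateVec s v := by
      intro s v hs
      rw [← LinearMap.mem_range, range_stateMap]
      exact Submodule.subset_span ⟨s, hs, v, rfl⟩
    ext i j
    -- The states of impulses at `t` and at `0` pair to the entries of `g (t + 0)` and `g (0 + t)`.
    obtain ⟨u, hu⟩ := hmem t (Pi.single i 1) ht
    obtain ⟨w, hw⟩ := hmem 0 (Pi.single j 1) le_rfl
    have h1 := h w u
    rw [real_inner_comm (S.hankel u) w, S.inner_hankel hA, S.inner_hankel hA, hu, hw,
      stateForm_stateVec, stateForm_stateVec, add_zero, zero_add] at h1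
    simpa using h1
  · intro h u w
    rw [real_inner_comm (S.hankel w) u, S.inner_hankel hA, S.inner_hankel hA]
    have hmem : ∀ u, S.stateMap hA u ∈
        Submodule.span ℝ {x | ∃ t : ℝ, 0 ≤ t ∧ ∃ v, S.stateVec t v = x} := by
      intro u
      rw [← range_stateMap S hA]
      exact LinearMap.mem_range_self _ u
    refine Submodule.span_induction₂ (p := fun x y _ _ => stateForm n x y = stateForm n y x)
      ?_ ?_ ?_ ?_ ?_ ?_ ?_ (hmem w) (hmem u)
    · rintro _ _ ⟨s, hs, v, rfl⟩ ⟨t, ht, z, rfl⟩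
      rw [stateForm_stateVec, stateForm_stateVec, add_comm t s, Matrix.dotProduct_mulVec,
        ← Matrix.mulVec_transpose, ← h _ (add_nonneg hs ht), dotProduct_comm]
    · intros; simp
    · intros; simp
    · intro x y z _ _ _ h1 h2
      rw [map_add, map_add, LinearMap.add_apply, h1, h2]
    · intro x y z _ _ _ h1 h2
      rw [map_add, map_add, LinearMap.add_apply, h1, h2]
    · intro c x y _ _ h1
      rw [map_smul, map_smul, LinearMap.smul_apply, h1]
    · intro c x y _ _ h1
      rw [map_smul, map_smul, LinearMap.smul_apply, h1]

theorem stateForm_sum_stateVec (S : LTISystem n m m) {ι : Type*} [Fintype ι] (t : ι → ℝ)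
    (v : ι → Fin m → ℝ) :
    stateForm n (∑ a, S.stateVec (t a) (v a)) (∑ a, S.stateVec (t a) (v a)) =
      ∑ a, ∑ b, v a ⬝ᵥ S.g (t a + t b) *ᵥ v b := by
  simp only [map_sum, LinearMap.sum_apply, stateForm_stateVec]
  exact Finset.sum_comm

/-- On sums of impulse states the form is exactly the quadratic sum of the kernel `g (s + t)`, and
these sums exhaust the range of `stateMap`. -/
theorem isPositiveOperator_hankel_iff (S : LTISystem n m m) (hA : IsHurwitz S.A) :
    IsPositiveOperator S.hankel ↔ IsHankelPositive S.g := by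
  constructor
  · intro h ι _ t v ht
    have hmem : ∑ a, S.stateVec (t a) (v a) ∈ LinearMap.range (S.stateMap hA) := by
      rw [range_stateMap]
      exact Submodule.sum_mem _ fun a _ => Submodule.subset_span ⟨t a, ht a, v a, rfl⟩
    obtain ⟨u, hu⟩ := hmem
    have h1 := h u
    rwa [S.inner_hankel hA, hu, stateForm_sum_stateVec] at h1
  · intro h u
    have hmem := LinearMap.mem_range_self (S.stateMap hA) u
    rw [range_stateMap, Submodule.mem_span_set'] at hmem
    obtain ⟨N, c, x, hx⟩ := hmem
    choose t ht v hv using fun a => (x a).2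
    rw [S.inner_hankel hA, ← hx]
    -- The coefficients of the linear combination are absorbed into the impulse vectors.
    simp only [← hv, ← map_smul]
    rw [stateForm_sum_stateVec]
    exact h (Fin N) t _ ht

end LTISystem

theorem theorem2 {n m : ℕ} (S : LTISystem n m m) (hA : IsHurwitz S.A) :
    S.HankelWellDefined ∧
    (S.IsRelaxation ↔ IsCyclicMonotone S.hankel ∧ (S.D = S.Dᵀ ∧ S.D.PosSemidef)) ∧
    (IsCyclicMonotone S.hankel ↔
      IsSelfAdjointOperator S.hankel ∧ IsPositiveOperator S.hankel) := by
  have hcyc : IsCyclicMonotone S.hankel ↔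
      IsSelfAdjointOperator S.hankel ∧ IsPositiveOperator S.hankel :=
    isCyclicMonotone_iff (S.hankelLinearMap hA)
  refine ⟨S.hankelWellDefined hA, ?_, hcyc⟩
  rw [LTISystem.IsRelaxation, hcyc, S.isSelfAdjointOperator_hankel_iff hA,
    S.isPositiveOperator_hankel_iff hA, S.isCompletelyMonotonic_g_iff_isHankelPositive hA,
    and_comm]
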